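/- Let $p$ be a prime and let $d \ge 3$, $e \ge 5$, $k \ge 1$, $n \ge 4$ be integers. Let $R_{e,k} \cong (\mathbb{Z}/p^e)[x]/(f)$ be the Galois ring, where $f$ is monic of degree $k$ and its reduction modulo $p$ is irreducible over $\mathbb{Z}/p$. Let $E \subset R_{e,k}^d$ and let $\alpha = (\alpha_1,\dots,\alpha_n) \in R_{e,k}^n$. Write $x\cdot y = \sum_{i=1}^d x_i y_i$. If $$|E| > \sqrt{14e}\; n\; p^{\,dek - dk/2 + nek/2 + n/2 - ek/2 + 3k/2},$$ then the number of tuples $(x_1,\dots,x_{n+1}) \in E^{n+1}$ with $x_j \cdot x_{j+1} = \alpha_j$ for all $1 \le j \le n$ is at most $$\frac{2|E|^{n+1}}{p^{nek}}.$$ In particular, the same bound holds for the number of $n$-chains, i.e. of such tuples whose points $x_1,\dots,x_{n+1}$ are pairwise distinct. -/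

import Mathlib

/-- `R` is (isomorphic to) the Galois ring `R_{e,k} = (ℤ/p^e)[X]/(f)`, where `f` is a monic
polynomial of degree `k` whose reduction modulo `p` is irreducible over `ℤ/p`.
(The divisibility `p ∣ p ^ e`, i.e. `e ≥ 1` for a prime `p`, is what makes the reduction map
`ℤ/p^e → ℤ/p` exist.) -/
def IsGaloisRing (p e k : ℕ) (R : Type*) [CommRing R] : Prop :=
  ∃ (h : p ∣ p ^ e) (f : Polynomial (ZMod (p ^ e))),
    f.Monic ∧ f.natDegree = k ∧ Irreducible (f.map (ZMod.castHom h (ZMod p))) ∧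
      Nonempty (R ≃+* AdjoinRoot f)

/-- All `(n+1)`-tuples `(x_1, …, x_{n+1}) ∈ E^{n+1}` (repetitions allowed) such that
`x_j · x_{j+1} = α_j` for every `1 ≤ j ≤ n`. -/
def pathConfigurations {R : Type*} [CommRing R] {d n : ℕ} (E : Finset (Fin d → R))
    (α : Fin n → R) : Set (Fin (n + 1) → Fin d → R) :=
  {x | (∀ i, x i ∈ E) ∧ ∀ j : Fin n, dotProduct (x j.castSucc) (x j.succ) = α j}

/-- The `n`-chains in `E`: the tuples as above whose `n + 1` points are pairwise distinct. -/
def chains {R : Type*} [CommRing R] {d n : ℕ} (E : Finset (Fin d → R))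
    (α : Fin n → R) : Set (Fin (n + 1) → Fin d → R) :=
  {x | x ∈ pathConfigurations E α ∧ Function.Injective x}

/-! The relation `x ⬝ᵥ y = t` on `E` is a matrix whose norm is controlled by Fourier analysis on
`R`. Its indicator is the average of `ψ (x ⬝ᵥ y - t)` over the additive characters `ψ`. The trivial
one contributes norm at most `|E| / |R|`. For nontrivial `ψ`, expanding the square bounds the norm
by `√(|R|ᵈ mᵈ)`: the vectors killed by `ψ` have all coordinates in a proper ideal, of size at most
`m = p ^ ((e - 1) * k)`. Hence the norm is at most `(|E| + λ) / |R|` with `λ = |R| √(|R|ᵈ mᵈ)`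
(`card_mul_sum_dotProduct_eq_le`). Iterating along the path gives at most `|E| ((|E| + λ) / |R|) ^
n` tuples (`ncard_pathConfigurations_le`). The size hypothesis forces `2nλ ≤ |E|`, so `(1 + λ / |E|)
^ n ≤ exp (1 / 2) ≤ 2`. -/

/-! ### Additive characters and the dot product form -/

/-- The largest ideal contained in the kernel of an additive character. -/
def AddChar.kerIdeal {R : Type*} [CommRing R] (ψ : AddChar R ℂ) : Ideal R where
  carrier := {a | ∀ r, ψ (a * r) = 1}
  zero_mem' r := by simp
  add_mem' {a b} ha hb r := by rw [add_mul, AddChar.map_add_eq_mul, ha, hb, one_mul]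
  smul_mem' c a ha r := by
    rw [smul_eq_mul, mul_comm c a, mul_assoc]
    exact ha _

lemma AddChar.kerIdeal_ne_top {R : Type*} [CommRing R] {ψ : AddChar R ℂ} (hψ : ψ ≠ 0) :
    ψ.kerIdeal ≠ ⊤ := by
  intro h
  apply hψ
  ext a
  have h1 : (1 : R) ∈ ψ.kerIdeal := h ▸ Submodule.mem_top
  simpa using h1 a

/-- The vectors `z` for which `y ↦ ψ (z ⬝ᵥ y)` is the trivial character. -/
def AddChar.dotKer {R : Type*} [CommRing R] {d : ℕ} (ψ : AddChar R ℂ) : Set (Fin d → R) :=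
  {z | ∀ y, ψ (dotProduct z y) = 1}

/-- Testing `z` against vectors supported on one coordinate puts every `z i` in `ψ.kerIdeal`, which
is proper. -/
lemma AddChar.ncard_dotKer_le {R : Type*} [CommRing R] [Finite R] {d m : ℕ}
    (hm : ∀ I : Ideal R, I ≠ ⊤ → Nat.card I ≤ m) {ψ : AddChar R ℂ} (hψ : ψ ≠ 0) :
    (ψ.dotKer (d := d)).ncard ≤ m ^ d := by
  have hsub : ψ.dotKer (d := d) ⊆ Set.pi Set.univ fun _ ↦ (ψ.kerIdeal : Set R) := by
    intro z hz i _ r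
    simpa using hz (Pi.single i r)
  refine (Set.ncard_le_ncard hsub (Set.toFinite _)).trans ?_
  have : Nat.card (Set.pi Set.univ fun _ : Fin d ↦ (ψ.kerIdeal : Set R))
      = Nat.card (Fin d → ψ.kerIdeal) :=
    Nat.card_congr (Equiv.Set.univPi _)
  rw [← Nat.card_coe_set_eq, this, Nat.card_fun, Nat.card_fin]
  exact Nat.pow_le_pow_left (hm _ (AddChar.kerIdeal_ne_top hψ)) d

open Classical in
lemma AddChar.sum_dotProduct {R : Type*} [CommRing R] [Fintype R] {d : ℕ} (ψ : AddChar R ℂ)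
    (z : Fin d → R) :
    ∑ y, ψ (dotProduct z y) = if z ∈ ψ.dotKer then (Fintype.card R : ℂ) ^ d else 0 := by
  let φ : AddChar (Fin d → R) ℂ :=
    { toFun := fun y ↦ ψ (dotProduct z y)
      map_zero_eq_one' := by simp
      map_add_eq_mul' := fun a b ↦ by rw [dotProduct_add, AddChar.map_add_eq_mul] }
  have h := AddChar.sum_eq_ite φ
  have h0 : φ = 0 ↔ z ∈ ψ.dotKer := by
    rw [DFunLike.ext_iff]
    rfl
  simp only [h0] at h
  simpa [φ] using h

open Classical in
/-- Schur's test for a translation-invariant relation. -/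
lemma sum_mul_indicator_sub_le {V : Type*} [AddCommGroup V] [Finite V] (S : Set V)
    (E : Finset V) (f : V → ℝ) :
    ∑ x ∈ E, ∑ x' ∈ E, f x * f x' * (if x - x' ∈ S then 1 else 0)
      ≤ S.ncard * ∑ x ∈ E, f x ^ 2 := by
  have hcount (g : V → V) (hg : Function.Injective g) :
      ∑ x' ∈ E, (if g x' ∈ S then (1 : ℝ) else 0) ≤ S.ncard := by
    rw [Finset.sum_boole, ← Set.ncard_coe_finset]
    refine Nat.cast_le.2 ?_
    refine Set.ncard_le_ncard_of_injOn g (fun a ha ↦ ?_) hg.injOn S.toFinite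
    simpa using (Finset.mem_filter.1 ha).2
  have h1 : ∑ x ∈ E, ∑ x' ∈ E, f x ^ 2 * (if x - x' ∈ S then (1 : ℝ) else 0)
      ≤ S.ncard * ∑ x ∈ E, f x ^ 2 := by
    rw [Finset.mul_sum]
    refine Finset.sum_le_sum fun x _ ↦ ?_
    rw [← Finset.mul_sum, mul_comm]
    exact mul_le_mul_of_nonneg_right (hcount (x - ·) sub_right_injective) (sq_nonneg _)
  have h2 : ∑ x ∈ E, ∑ x' ∈ E, f x' ^ 2 * (if x - x' ∈ S then (1 : ℝ) else 0)
      ≤ S.ncard * ∑ x ∈ E, f x ^ 2 := by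
    rw [Finset.sum_comm, Finset.mul_sum]
    refine Finset.sum_le_sum fun x _ ↦ ?_
    rw [← Finset.mul_sum, mul_comm]
    exact mul_le_mul_of_nonneg_right (hcount (· - x) sub_left_injective) (sq_nonneg _)
  have h3 : ∑ x ∈ E, ∑ x' ∈ E, f x * f x' * (if x - x' ∈ S then (1 : ℝ) else 0)
      ≤ ∑ x ∈ E, ∑ x' ∈ E, (f x ^ 2 * (if x - x' ∈ S then (1 : ℝ) else 0)
        + f x' ^ 2 * (if x - x' ∈ S then (1 : ℝ) else 0)) / 2 := by
    -- Here `2ab ≤ a² + b²` decouples the two variables.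
    refine Finset.sum_le_sum fun x _ ↦ Finset.sum_le_sum fun x' _ ↦ ?_
    split_ifs
    · nlinarith [sq_nonneg (f x - f x')]
    · simp
  simp only [← Finset.sum_div, Finset.sum_add_distrib] at h3
  linarith

/-- The `L²` bound for the exponential sum operator attached to a nontrivial character. -/
lemma AddChar.sum_norm_sq_dotProduct_le {R : Type*} [CommRing R] [Fintype R] {d m : ℕ}
    (hm : ∀ I : Ideal R, I ≠ ⊤ → Nat.card I ≤ m) {ψ : AddChar R ℂ} (hψ : ψ ≠ 0)
    (E : Finset (Fin d → R)) (f : (Fin d → R) → ℝ) :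
    ∑ y, ‖∑ x ∈ E, (f x : ℂ) * ψ (dotProduct x y)‖ ^ 2
      ≤ (Fintype.card R : ℝ) ^ d * (m : ℝ) ^ d * ∑ x ∈ E, f x ^ 2 := by
  classical
  -- After expanding the square, orthogonality in `y` keeps only the pairs with `x - x'` in
  -- `ψ.dotKer`.
  have key : ∑ y, ‖∑ x ∈ E, (f x : ℂ) * ψ (dotProduct x y)‖ ^ 2
      = (Fintype.card R : ℝ) ^ d * ∑ x ∈ E, ∑ x' ∈ E,
        f x * f x' * (if x - x' ∈ ψ.dotKer then 1 else 0) := by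
    apply Complex.ofReal_injective
    push_cast
    simp_rw [← Complex.mul_conj', map_sum, Finset.sum_mul_sum, map_mul, Complex.conj_ofReal]
    rw [Finset.sum_comm, Finset.mul_sum]
    refine Finset.sum_congr rfl fun x _ ↦ ?_
    rw [Finset.sum_comm, Finset.mul_sum]
    refine Finset.sum_congr rfl fun x' _ ↦ ?_
    have h (y : Fin d → R) : (f x : ℂ) * ψ (dotProduct x y) *
        ((f x' : ℂ) * (starRingEnd ℂ) (ψ (dotProduct x' y)))
        = (f x : ℂ) * f x' * ψ (dotProduct (x - x') y) := by
      rw [sub_dotProduct, sub_eq_add_neg, AddChar.map_add_eq_mul, AddChar.map_neg_eq_conj]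
      ring
    simp_rw [h]
    rw [← Finset.mul_sum, AddChar.sum_dotProduct]
    split_ifs <;> push_cast <;> ring
  rw [key, mul_assoc]
  refine mul_le_mul_of_nonneg_left ((sum_mul_indicator_sub_le _ _ _).trans ?_) (by positivity)
  refine mul_le_mul_of_nonneg_right ?_ (Finset.sum_nonneg fun _ _ ↦ sq_nonneg _)
  exact_mod_cast AddChar.ncard_dotKer_le hm hψ

open Classical in
/-- The dot product relation `x ⬝ᵥ y = t` is pseudorandom on `E`: its bilinear form has norm at
most `(|E| + |R| √(|R|ᵈ mᵈ)) / |R|`, where `m` bounds the size of the proper ideals. -/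
lemma card_mul_sum_dotProduct_eq_le {R : Type*} [CommRing R] [Fintype R] {d m : ℕ}
    (hm : ∀ I : Ideal R, I ≠ ⊤ → Nat.card I ≤ m) (t : R)
    (E : Finset (Fin d → R)) (f h : (Fin d → R) → ℝ) :
    (Fintype.card R : ℝ) *
        ∑ y ∈ E, h y * ∑ x ∈ E, f x * (if dotProduct x y = t then 1 else 0)
      ≤ (E.card + Fintype.card R * √((Fintype.card R : ℝ) ^ d * (m : ℝ) ^ d))
        * (√(∑ x ∈ E, h x ^ 2) * √(∑ x ∈ E, f x ^ 2)) := by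
  set T : AddChar R ℂ → (Fin d → R) → ℂ := fun ψ y ↦ ∑ x ∈ E, (f x : ℂ) * ψ (dotProduct x y)
    with hT
  set Q : ℝ := (Fintype.card R : ℝ) with hQ
  set H := √(∑ x ∈ E, h x ^ 2)
  set F := √(∑ x ∈ E, f x ^ 2)
  have hF : 0 ≤ ∑ x ∈ E, f x ^ 2 := Finset.sum_nonneg fun _ _ ↦ sq_nonneg _
  have expand : ((Q * ∑ y ∈ E, h y * ∑ x ∈ E, f x * (if dotProduct x y = t then 1 else 0) : ℝ) : ℂ)
      = ∑ ψ : AddChar R ℂ, ψ (-t) * ∑ y ∈ E, (h y : ℂ) * T ψ y := by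
    have h1 (x y : Fin d → R) : ((Q * (if dotProduct x y = t then 1 else 0) : ℝ) : ℂ)
        = ∑ ψ : AddChar R ℂ, ψ (-t) * ψ (dotProduct x y) := by
      simp_rw [← AddChar.map_add_eq_mul, AddChar.sum_apply_eq_ite, neg_add_eq_zero, eq_comm (a := t)]
      split_ifs <;> simp [hQ]
    simp only [hT, Finset.mul_sum]
    push_cast
    conv_rhs => rw [Finset.sum_comm]
    refine Finset.sum_congr rfl fun y _ ↦ ?_
    conv_rhs => rw [Finset.sum_comm]
    refine Finset.sum_congr rfl fun x _ ↦ ?_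
    calc _ = (h y * f x : ℂ) * ((Q * (if dotProduct x y = t then 1 else 0) : ℝ) : ℂ) := by
          push_cast
          ring
      _ = _ := by
          rw [h1, Finset.mul_sum]
          exact Finset.sum_congr rfl fun ψ _ ↦ by ring
  have term (ψ : AddChar R ℂ) : ‖ψ (-t) * ∑ y ∈ E, (h y : ℂ) * T ψ y‖
      ≤ H * √(∑ y ∈ E, ‖T ψ y‖ ^ 2) := by
    rw [norm_mul, AddChar.norm_apply, one_mul]
    refine (norm_sum_le _ _).trans ?_
    have := Real.sum_mul_le_sqrt_mul_sqrt E (fun y ↦ |h y|) (fun y ↦ ‖T ψ y‖)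
    simpa [sq_abs] using this
  have triv : √(∑ y ∈ E, ‖T 0 y‖ ^ 2) ≤ E.card * F := by
    have h1 : ∑ y ∈ E, ‖T 0 y‖ ^ 2 ≤ (E.card * F) ^ 2 := by
      have h2 : ∀ y ∈ E, ‖T 0 y‖ ^ 2 ≤ E.card * ∑ x ∈ E, f x ^ 2 := fun y _ ↦ by
        have : T 0 y = ((∑ x ∈ E, f x : ℝ) : ℂ) := by simp [hT]
        rw [this, Complex.norm_real, Real.norm_eq_abs, sq_abs]
        exact sq_sum_le_card_mul_sum_sq
      refine (Finset.sum_le_sum h2).trans (le_of_eq ?_)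
      rw [Finset.sum_const, nsmul_eq_mul, mul_pow, Real.sq_sqrt hF]
      ring
    exact Real.sqrt_le_left (by positivity) |>.2 h1
  have nontriv (ψ : AddChar R ℂ) (hψ : ψ ≠ 0) :
      √(∑ y ∈ E, ‖T ψ y‖ ^ 2) ≤ √(Q ^ d * (m : ℝ) ^ d) * F := by
    rw [← Real.sqrt_mul (by positivity)]
    refine Real.sqrt_le_sqrt ?_
    -- Positivity allows `y` to range over the whole space, where orthogonality applies.
    exact (Finset.sum_le_sum_of_subset_of_nonneg (Finset.subset_univ _)
      fun _ _ _ ↦ sq_nonneg _).trans (AddChar.sum_norm_sq_dotProduct_le hm hψ E f)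
  have hcard : ((Finset.univ.erase (0 : AddChar R ℂ)).card : ℝ) ≤ Q := by
    rw [hQ, ← AddChar.card_eq (α := R)]
    exact_mod_cast Finset.card_le_univ _
  have hbound : ‖∑ ψ : AddChar R ℂ, ψ (-t) * ∑ y ∈ E, (h y : ℂ) * T ψ y‖
      ≤ (E.card + Q * √(Q ^ d * (m : ℝ) ^ d)) * (H * F) := by
    rw [← Finset.add_sum_erase _ _ (Finset.mem_univ (0 : AddChar R ℂ))]
    refine (norm_add_le _ _).trans ?_
    rw [add_mul]
    refine add_le_add ((term 0).trans ?_) ?_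
    · calc _ ≤ H * (E.card * F) := mul_le_mul_of_nonneg_left triv (Real.sqrt_nonneg _)
        _ = _ := by ring
    · refine (norm_sum_le _ _).trans ?_
      have h4 : ∀ ψ ∈ Finset.univ.erase (0 : AddChar R ℂ),
          ‖ψ (-t) * ∑ y ∈ E, (h y : ℂ) * T ψ y‖ ≤ H * (√(Q ^ d * (m : ℝ) ^ d) * F) :=
        fun ψ hψ ↦ (term ψ).trans
          (mul_le_mul_of_nonneg_left (nontriv ψ (Finset.ne_of_mem_erase hψ)) (Real.sqrt_nonneg _))
      refine (Finset.sum_le_card_nsmul _ _ _ h4).trans ?_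
      rw [nsmul_eq_mul]
      calc _ ≤ Q * (H * (√(Q ^ d * (m : ℝ) ^ d) * F)) :=
            mul_le_mul_of_nonneg_right hcard (by positivity)
        _ = _ := by ring
  rw [← expand, Complex.norm_real] at hbound
  exact (Real.le_norm_self _).trans hbound

/-! ### Counting paths by iterating the form -/

open Classical in
/-- The number of configurations in `E` starting at a given point of `E`, computed recursively. -/
noncomputable def pathWeight {R : Type*} [CommRing R] {d : ℕ} (E : Finset (Fin d → R)) :
    (n : ℕ) → (Fin n → R) → (Fin d → R) → ℝ
  | 0, _, _ => 1
  | n + 1, α, y =>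
    ∑ x ∈ E, pathWeight E n (Fin.tail α) x * (if dotProduct x y = α 0 then 1 else 0)

lemma pathWeight_nonneg {R : Type*} [CommRing R] {d : ℕ} (E : Finset (Fin d → R))
    (n : ℕ) (α : Fin n → R) (y : Fin d → R) : 0 ≤ pathWeight E n α y := by
  induction n generalizing y with
  | zero => exact zero_le_one
  | succ n ih =>
    exact Finset.sum_nonneg fun x _ ↦ mul_nonneg (ih _ _) (by split_ifs <;> norm_num)

lemma ncard_pathConfigurations_start_le {R : Type*} [CommRing R] [Finite R] {d : ℕ}
    (E : Finset (Fin d → R)) (n : ℕ) (α : Fin n → R) (y : Fin d → R) :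
    ({x | x ∈ pathConfigurations E α ∧ x 0 = y}.ncard : ℝ) ≤ pathWeight E n α y := by
  classical
  induction n generalizing y with
  | zero =>
    have : {x | x ∈ pathConfigurations E α ∧ x 0 = y} ⊆ {fun _ ↦ y} := by
      rintro x ⟨-, hx⟩
      rw [Set.mem_singleton_iff]
      funext i
      rw [Fin.fin_one_eq_zero i, hx]
    have h := Set.ncard_le_ncard this
    rw [Set.ncard_singleton] at h
    simpa [pathWeight] using h
  | succ n ih =>
    have hsub : {x | x ∈ pathConfigurations E α ∧ x 0 = y} ⊆
        ⋃ z ∈ E.filter (fun z ↦ dotProduct z y = α 0),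
          (fun x' ↦ (Fin.cons y x' : Fin (n + 2) → Fin d → R)) ''
          {x' | x' ∈ pathConfigurations E (Fin.tail α) ∧ x' 0 = z} := by
      rintro x ⟨⟨hE, hx⟩, rfl⟩
      simp only [Set.mem_iUnion]
      refine ⟨x 1, Finset.mem_filter.2 ⟨hE _, ?_⟩, Fin.tail x, ⟨⟨fun i ↦ hE _, fun j ↦ ?_⟩, rfl⟩,
        Fin.cons_self_tail x⟩
      · rw [dotProduct_comm]
        exact hx 0
      · exact hx j.succ
    have h1 := (Set.ncard_le_ncard hsub (Set.toFinite _)).trans (Finset.set_ncard_biUnion_le _ _)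
    refine (Nat.cast_le.2 h1).trans ?_
    rw [Nat.cast_sum, Finset.sum_filter, pathWeight]
    refine Finset.sum_le_sum fun z _ ↦ ?_
    split_ifs
    · rw [mul_one]
      exact (Nat.cast_le.2 (Set.ncard_image_le (Set.toFinite _))).trans (ih _ _)
    · simp

/-- Taking `h` in `hB` to be the new weight itself gives `G² ≤ C G G'`, with `G'` the norm of the
previous weight; cancelling `G` gains one factor `C` per edge. -/
lemma sqrt_sum_sq_pathWeight_le {R : Type*} [CommRing R] {d : ℕ} (E : Finset (Fin d → R)) {C : ℝ}
    (hC : 0 ≤ C)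
    (hB : ∀ (t : R) (f h : (Fin d → R) → ℝ), open Classical in
      ∑ y ∈ E, h y * ∑ x ∈ E, f x * (if dotProduct x y = t then 1 else 0)
        ≤ C * (√(∑ x ∈ E, h x ^ 2) * √(∑ x ∈ E, f x ^ 2))) (n : ℕ) (α : Fin n → R) :
    √(∑ y ∈ E, pathWeight E n α y ^ 2) ≤ C ^ n * √E.card := by
  induction n with
  | zero => simp [pathWeight]
  | succ n ih =>
    set G := √(∑ y ∈ E, pathWeight E (n + 1) α y ^ 2) with hG
    have h1 := hB (α 0) (pathWeight E n (Fin.tail α)) (pathWeight E (n + 1) α)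
    have h2 : G * G ≤ C * (G * √(∑ y ∈ E, pathWeight E n (Fin.tail α) y ^ 2)) := by
      rw [hG, Real.mul_self_sqrt (Finset.sum_nonneg fun _ _ ↦ sq_nonneg _)]
      refine le_trans (le_of_eq (Finset.sum_congr rfl fun y _ ↦ ?_)) h1
      rw [sq]
      rfl
    rcases (Real.sqrt_nonneg _ : 0 ≤ G).eq_or_lt with h0 | h0
    · exact h0.symm.trans_le (by positivity)
    · have h3 : G ≤ C * √(∑ y ∈ E, pathWeight E n (Fin.tail α) y ^ 2) := by
        refine le_of_mul_le_mul_left (h2.trans (le_of_eq ?_)) h0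
        ring
      refine h3.trans ((mul_le_mul_of_nonneg_left (ih _) hC).trans (le_of_eq ?_))
      ring

lemma ncard_pathConfigurations_le {R : Type*} [CommRing R] [Finite R] {d : ℕ}
    (E : Finset (Fin d → R)) {C : ℝ} (hC : 0 ≤ C)
    (hB : ∀ (t : R) (f h : (Fin d → R) → ℝ), open Classical in
      ∑ y ∈ E, h y * ∑ x ∈ E, f x * (if dotProduct x y = t then 1 else 0)
        ≤ C * (√(∑ x ∈ E, h x ^ 2) * √(∑ x ∈ E, f x ^ 2))) (n : ℕ) (α : Fin n → R) :
    ((pathConfigurations E α).ncard : ℝ) ≤ C ^ n * E.card := by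
  have hsub : pathConfigurations E α ⊆
      ⋃ y ∈ E, {x | x ∈ pathConfigurations E α ∧ x 0 = y} := by
    intro x hx
    simp only [Set.mem_iUnion]
    exact ⟨x 0, hx.1 0, hx, rfl⟩
  have h1 := (Set.ncard_le_ncard hsub (Set.toFinite _)).trans (Finset.set_ncard_biUnion_le _ _)
  calc ((pathConfigurations E α).ncard : ℝ)
      ≤ ∑ y ∈ E, 1 * pathWeight E n α y := by
        refine (Nat.cast_le.2 h1).trans ?_
        rw [Nat.cast_sum]
        exact Finset.sum_le_sum fun y _ ↦
          (ncard_pathConfigurations_start_le E n α y).trans (one_mul _).ge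
    _ ≤ √(∑ y ∈ E, 1 ^ 2) * √(∑ y ∈ E, pathWeight E n α y ^ 2) :=
        Real.sum_mul_le_sqrt_mul_sqrt E _ _
    _ ≤ √E.card * (C ^ n * √E.card) := by
        simp only [one_pow, Finset.sum_const, nsmul_eq_mul, mul_one]
        exact mul_le_mul_of_nonneg_left (sqrt_sum_sq_pathWeight_le E hC hB n α)
          (Real.sqrt_nonneg _)
    _ = C ^ n * E.card := by
        rw [mul_left_comm, Real.mul_self_sqrt (Nat.cast_nonneg _)]

/-! ### Ideals of the Galois ring -/

lemma IsGaloisRing.finite_and_card {p e k : ℕ} (hp : p.Prime) {R : Type*} [CommRing R]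
    (hR : IsGaloisRing p e k R) : Finite R ∧ Nat.card R = p ^ (e * k) := by
  obtain ⟨h, f, hf, hdeg, -, ⟨φ⟩⟩ := hR
  have : NeZero (p ^ e) := ⟨pow_ne_zero _ hp.ne_zero⟩
  let b := (AdjoinRoot.powerBasis' hf).basis
  have hdim : (AdjoinRoot.powerBasis' hf).dim = k := by rw [AdjoinRoot.powerBasis'_dim, hdeg]
  let ψ := φ.toEquiv.trans b.equivFun.toEquiv
  refine ⟨Finite.of_equiv _ ψ.symm, ?_⟩
  rw [Nat.card_congr ψ, Nat.card_fun, Nat.card_fin, Nat.card_zmod, hdim, pow_mul]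

/-- Since `p` is nilpotent in `R`, it vanishes in `K`, so `g` induces a map to `K` from the field of
order `p ^ k` defined by `f` mod `p`; such a map is injective. This bounds the index of maximal
ideals without showing that `R` is local. -/
lemma IsGaloisRing.le_card_field {p e k : ℕ} (hp : p.Prime) {R : Type*} [CommRing R]
    (hR : IsGaloisRing p e k R) {K : Type*} [Field K] [Finite K] (g : R →+* K) :
    p ^ k ≤ Nat.card K := by
  obtain ⟨h, f, hf, hdeg, hirr, ⟨φ⟩⟩ := hR
  have : Fact p.Prime := ⟨hp⟩
  have : NeZero (p ^ e) := ⟨pow_ne_zero _ hp.ne_zero⟩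
  let g' : AdjoinRoot f →+* K := g.comp φ.symm.toRingHom
  have hpK : (p : K) = 0 := by
    have h1 : ((p ^ e : ℕ) : AdjoinRoot f) = 0 := by
      rw [← map_natCast (AdjoinRoot.of f), ZMod.natCast_self, map_zero]
    have h2 := congrArg g' h1
    rw [map_natCast, map_zero, Nat.cast_pow] at h2
    exact eq_zero_of_pow_eq_zero h2
  have : CharP K p := by
    refine (CharP.charP_iff_prime_eq_zero hp).2 hpK
  let c : ZMod p →+* K := ZMod.castHom dvd_rfl K
  have hc : c.comp (ZMod.castHom h (ZMod p)) = g'.comp (AdjoinRoot.of f) := RingHom.ext_zmod _ _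
  have : Fact (Irreducible (f.map (ZMod.castHom h (ZMod p)))) := ⟨hirr⟩
  have hmon := hf.map (ZMod.castHom h (ZMod p))
  let l : AdjoinRoot (f.map (ZMod.castHom h (ZMod p))) →+* K :=
    AdjoinRoot.lift c (g' (AdjoinRoot.root f)) (by
      rw [Polynomial.eval₂_map, hc, ← Polynomial.hom_eval₂, AdjoinRoot.eval₂_root, map_zero])
  have hcard : Nat.card (AdjoinRoot (f.map (ZMod.castHom h (ZMod p)))) = p ^ k := by
    rw [Nat.card_congr (AdjoinRoot.powerBasis' hmon).basis.equivFun.toEquiv, Nat.card_fun,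
      Nat.card_fin, Nat.card_zmod, AdjoinRoot.powerBasis'_dim, hf.natDegree_map, hdeg]
  rw [← hcard]
  exact Nat.card_le_card_of_injective l l.injective

lemma IsGaloisRing.card_ideal_le {p e k : ℕ} (hp : p.Prime) (he : 1 ≤ e) {R : Type*} [CommRing R]
    (hR : IsGaloisRing p e k R) (I : Ideal R) (hI : I ≠ ⊤) :
    Nat.card I ≤ p ^ ((e - 1) * k) := by
  obtain ⟨_, hcard⟩ := hR.finite_and_card hp
  obtain ⟨M, hM, hIM⟩ := I.exists_le_maximal hI
  let _ := Ideal.Quotient.field M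
  have : Finite (R ⧸ M) := .of_surjective _ (Ideal.Quotient.mk_surjective (I := M))
  have hq : p ^ k ≤ Nat.card (R ⧸ M) := hR.le_card_field hp (Ideal.Quotient.mk M)
  have hmul : Nat.card R = Nat.card M * Nat.card (R ⧸ M) :=
    Submodule.card_eq_card_quotient_mul_card M
  have hIM' : Nat.card I ≤ Nat.card M :=
    Nat.card_le_card_of_injective (Set.inclusion hIM) (Set.inclusion_injective hIM)
  refine hIM'.trans (Nat.le_of_mul_le_mul_right ?_ (pow_pos hp.pos k))
  rw [← pow_add, show (e - 1) * k + k = e * k by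
    obtain ⟨e, rfl⟩ := Nat.exists_eq_add_of_le' he; simp; ring, ← hcard, hmul]
  exact Nat.mul_le_mul_left _ hq

/-! ### Numerical estimates and conclusion -/

lemma one_add_div_pow_le_two {n : ℕ} {u : ℝ} (hu : 0 ≤ u) (h : n * u ≤ 1 / 2) :
    (1 + u) ^ n ≤ 2 := by
  calc (1 + u) ^ n ≤ Real.exp u ^ n :=
        pow_le_pow_left₀ (by positivity) (by linarith [Real.add_one_le_exp u]) n
    _ = Real.exp (n * u) := (Real.exp_nat_mul u n).symm
    _ ≤ Real.exp (1 / 2) := Real.exp_le_exp.2 h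
    _ ≤ 2 := by
        have h1 : Real.exp (1 / 2) ^ 2 ≤ 2 ^ 2 := by
          rw [← Real.exp_nat_mul]
          have := Real.exp_one_lt_d9
          norm_num
          linarith
        exact le_of_sq_le_sq h1 (by norm_num)

lemma card_mul_sqrt_eq_rpow {p : ℕ} (hp : p.Prime) (e k d : ℕ) (he : 1 ≤ e) :
    ((p ^ (e * k) : ℕ) : ℝ) * √(((p ^ (e * k) : ℕ) : ℝ) ^ d * ((p ^ ((e - 1) * k) : ℕ) : ℝ) ^ d)
      = (p : ℝ) ^ ((e : ℝ) * k + ((d : ℝ) * e * k - (d : ℝ) * k / 2)) := by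
  have hp0 : (0 : ℝ) < p := Nat.cast_pos.2 hp.pos
  rw [Real.rpow_add hp0]
  congr 1
  · rw [← Nat.cast_mul, Real.rpow_natCast, Nat.cast_pow]
  · rw [Real.sqrt_eq_rpow]
    push_cast
    simp only [← pow_mul, ← pow_add]
    rw [← Real.rpow_natCast, ← Real.rpow_mul hp0.le]
    congr 1
    push_cast [Nat.cast_sub he]
    ring

theorem corollary19 (p e k d n : ℕ) (hp : p.Prime) (hd : 3 ≤ d) (he : 5 ≤ e) (hk : 1 ≤ k)
    (hn : 4 ≤ n) (R : Type*) [CommRing R] (hR : IsGaloisRing p e k R)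
    (E : Finset (Fin d → R)) (α : Fin n → R)
    (hE : (E.card : ℝ) > Real.sqrt (14 * e) * n *
      (p : ℝ) ^ ((d : ℝ) * e * k - (d : ℝ) * k / 2 + (n : ℝ) * e * k / 2 + (n : ℝ) / 2
        - (e : ℝ) * k / 2 + 3 * (k : ℝ) / 2)) :
    ((pathConfigurations E α).ncard : ℝ) ≤ 2 * (E.card : ℝ) ^ (n + 1) / (p : ℝ) ^ (n * e * k) ∧
    ((chains E α).ncard : ℝ) ≤ 2 * (E.card : ℝ) ^ (n + 1) / (p : ℝ) ^ (n * e * k) := by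
  obtain ⟨_, hcard⟩ := hR.finite_and_card hp
  have main : ((pathConfigurations E α).ncard : ℝ)
      ≤ 2 * (E.card : ℝ) ^ (n + 1) / (p : ℝ) ^ (n * e * k) := by
    cases nonempty_fintype R
    rw [Nat.card_eq_fintype_card] at hcard
    have hp1 : (1 : ℝ) ≤ p := Nat.one_le_cast.2 hp.one_le
    have hp0 : (0 : ℝ) < p := by linarith
    set lam : ℝ := (p : ℝ) ^ ((e : ℝ) * k + ((d : ℝ) * e * k - (d : ℝ) * k / 2)) with hlam
    have hlam0 : 0 < lam := Real.rpow_pos_of_pos hp0 _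
    have hQ : (0 : ℝ) < (p : ℝ) ^ (e * k) := pow_pos hp0 _
    have hn0 : (0 : ℝ) < n := by exact_mod_cast (by omega : 0 < n)
    have hsmall : 2 * n * lam ≤ E.card := by
      refine le_trans ?_ hE.le
      have hs : (2 : ℝ) ≤ √(14 * e) := by
        refine Real.le_sqrt_of_sq_le ?_
        have : (5 : ℝ) ≤ e := by exact_mod_cast he
        linarith
      refine mul_le_mul (mul_le_mul_of_nonneg_right hs hn0.le)
        (Real.rpow_le_rpow_of_exponent_le hp1 ?_) hlam0.le (by positivity)
      have hn' : (4 : ℝ) ≤ n := by exact_mod_cast hn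
      have hek : (0 : ℝ) ≤ (e : ℝ) * k := by positivity
      have hk0 : (0 : ℝ) ≤ k := by positivity
      -- The exponents differ by `(n - 3)ek/2 + n/2 + 3k/2`, which is nonnegative.
      nlinarith
    have hE0 : (0 : ℝ) < E.card := lt_of_lt_of_le (by positivity) hsmall
    have hB (t : R) (f h : (Fin d → R) → ℝ) : open Classical in
        ∑ y ∈ E, h y * ∑ x ∈ E, f x * (if dotProduct x y = t then 1 else 0)
          ≤ (E.card + lam) / (p : ℝ) ^ (e * k)
            * (√(∑ x ∈ E, h x ^ 2) * √(∑ x ∈ E, f x ^ 2)) := by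
      have h1 := card_mul_sum_dotProduct_eq_le (hR.card_ideal_le hp (by omega)) t E f h
      rw [hcard, card_mul_sqrt_eq_rpow hp e k d (by omega), ← hlam, Nat.cast_pow] at h1
      rw [div_mul_eq_mul_div, le_div_iff₀ hQ, mul_comm]
      exact h1
    refine (ncard_pathConfigurations_le E (by positivity) hB n α).trans ?_
    have h2 : (1 + lam / E.card) ^ n ≤ 2 := by
      refine one_add_div_pow_le_two (by positivity) ?_
      rw [← mul_div_assoc, div_le_iff₀ hE0]
      linarith
    have h3 : (E.card : ℝ) + lam = E.card * (1 + lam / E.card) := by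
      field_simp
    rw [h3, div_pow, mul_pow, ← pow_mul, show e * k * n = n * e * k by ring, div_mul_eq_mul_div]
    refine div_le_div_of_nonneg_right ?_ (by positivity)
    calc (E.card : ℝ) ^ n * (1 + lam / E.card) ^ n * E.card
        = (1 + lam / E.card) ^ n * (E.card : ℝ) ^ (n + 1) := by ring
      _ ≤ 2 * (E.card : ℝ) ^ (n + 1) := mul_le_mul_of_nonneg_right h2 (by positivity)
  refine ⟨main, le_trans (Nat.cast_le.2 ?_) main⟩
  exact Set.ncard_le_ncard (fun x hx ↦ hx.1) (Set.toFinite _)
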